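/- Let $M,N\ge 1$ be integers. A family $\Phi=\{\varphi_i\}_{i=1}^M\subset\mathbb R^N$, also viewed as the $N\times M$ matrix with columns $\varphi_i$, is a frame if there are $0<A\le B<\infty$ with $A\|x\|^2\le\sum_i|\langle x,\varphi_i\rangle|^2\le B\|x\|^2$ for all $x\in\mathbb R^N$; it is tight if one can take $A=B$. A frame is scalable if there are scalars $s_i\ge 0$ such that $\{s_i\varphi_i\}_{i=1}^M$ is a tight frame, and $\mathcal{SC}(M,N)$ denotes the set of scalable frames of $M$ vectors in $\mathbb R^N$. Let $\Phi=\{\varphi_i\}_{i=1}^M$ be a frame for $\mathbb R^N$ with $\|\varphi_i\|_2=1$ for all $i$, and put $$d_\Phi=\inf_{\Psi\in\mathcal{SC}(M,N)}\|\Phi-\Psi\|_F,\qquad D_\Phi=\min_{C\ge 0\ \text{diagonal}}\|\Phi C\Phi^T-I\|_F,\qquad V_\Phi=\frac{\operatorname{Vol}(E_\Phi)}{\omega_N},$$ where $\|\cdot\|_F$ is the Frobenius norm, $E_\Phi$ is the ellipsoid of minimal volume containing the convex hull of $\{\pm\varphi_i\}_{i=1}^M$, and $\omega_N$ is the volume of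 the unit ball of $\mathbb R^N$. If $d_\Phi<1$, then with $K=\min\{M,\tfrac{N(N+1)}2\}$ and $\omega=D_\Phi+\sqrt K$ we have $$\frac{D_\Phi}{\omega+\sqrt{\omega^2-D_\Phi^2}}\le d_\Phi\le\sqrt{KN\left(1-V_\Phi^{2/N}\right)}.$$ Consequently, $d_\Phi$ is bounded below and above by expressions of $D_\Phi$ alone and by expressions of $V_\Phi$ alone: if moreover $D_\Phi<1$, then $$d_\Phi\le\sqrt{KN\left(1-\sqrt{\frac{N(1-D_\Phi^2)}{N-D_\Phi^2}}\right)},$$ and if $N\ge 2$, then with $\delta=\sqrt{\dfrac{N(1-V_\Phi^{4/N})}{N-V_\Phi^{4/N}}}$, $$\frac{\delta}{(\delta+\sqrt K)+\sqrt{(\delta+\sqrt K)^2-\delta^2}}\le d_\Phi.$$ -/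

import Mathlib

namespace ScalableFrame

open MeasureTheory

/-- The family `φ` of `M` vectors is a frame for `ℝ^N`. -/
def IsFrame {M N : ℕ} (φ : Fin M → EuclideanSpace ℝ (Fin N)) : Prop :=
  ∃ A B : ℝ, 0 < A ∧ 0 < B ∧ ∀ x : EuclideanSpace ℝ (Fin N),
    A * ‖x‖ ^ 2 ≤ ∑ i, (inner ℝ x (φ i)) ^ 2 ∧ ∑ i, (inner ℝ x (φ i)) ^ 2 ≤ B * ‖x‖ ^ 2

/-- A frame whose two frame bounds can be chosen equal. -/
def IsTightFrame {M N : ℕ} (φ : Fin M → EuclideanSpace ℝ (Fin N)) : Prop :=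
  ∃ A : ℝ, 0 < A ∧ ∀ x : EuclideanSpace ℝ (Fin N),
    ∑ i, (inner ℝ x (φ i)) ^ 2 = A * ‖x‖ ^ 2

/-- A frame is scalable if its vectors can be rescaled by nonnegative scalars
to form a tight frame. -/
def IsScalable {M N : ℕ} (φ : Fin M → EuclideanSpace ℝ (Fin N)) : Prop :=
  IsFrame φ ∧ ∃ s : Fin M → ℝ, (∀ i, 0 ≤ s i) ∧ IsTightFrame (fun i => s i • φ i)

/-- A frame all of whose vectors have Euclidean norm one. -/
def IsUnitNormFrame {M N : ℕ} (φ : Fin M → EuclideanSpace ℝ (Fin N)) : Prop :=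
  IsFrame φ ∧ ∀ i, ‖φ i‖ = 1

/-- The `N × M` matrix whose `i`-th column is `φ i`. -/
def frameMatrix {M N : ℕ} (φ : Fin M → EuclideanSpace ℝ (Fin N)) :
    Matrix (Fin N) (Fin M) ℝ :=
  Matrix.of fun j i => φ i j

section Frobenius

open scoped Matrix.Norms.Frobenius

/-- The Frobenius distance of `φ` to the set of scalable frames of `M` vectors in `ℝ^N`. -/
noncomputable def distScalable {M N : ℕ} (φ : Fin M → EuclideanSpace ℝ (Fin N)) : ℝ :=
  ⨅ ψ : {ψ : Fin M → EuclideanSpace ℝ (Fin N) // IsScalable ψ},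
    ‖frameMatrix φ - frameMatrix ψ.1‖

/-- The Frobenius distance of the identity matrix to the cone of all `Φ C Φᵀ` with `C` diagonal
and nonnegative. -/
noncomputable def distCone {M N : ℕ} (φ : Fin M → EuclideanSpace ℝ (Fin N)) : ℝ :=
  ⨅ c : {c : Fin M → ℝ // ∀ i, 0 ≤ c i},
    ‖frameMatrix φ * Matrix.diagonal c.1 * (frameMatrix φ).transpose - 1‖

end Frobenius

/-- The set `{v | ⟨X (v - c), v - c⟩ ≤ 1}`; it is an ellipsoid with center `c` when `X` is
positive definite. -/
def ellipsoid {N : ℕ} (X : Matrix (Fin N) (Fin N) ℝ) (c : EuclideanSpace ℝ (Fin N)) :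
    Set (EuclideanSpace ℝ (Fin N)) :=
  {v | inner ℝ (X.toEuclideanLin (v - c)) (v - c) ≤ 1}

/-- The symmetrized frame `{φ i} ∪ {-φ i}`. -/
def symmetrized {M N : ℕ} (φ : Fin M → EuclideanSpace ℝ (Fin N)) :
    Set (EuclideanSpace ℝ (Fin N)) :=
  Set.range φ ∪ Set.range (fun i => -φ i)

/-- The volume of the ellipsoid of minimal volume that contains `K`: the least volume of an
ellipsoid (with any center) containing `K`. -/
noncomputable def minEllipsoidVolume {N : ℕ} (K : Set (EuclideanSpace ℝ (Fin N))) : ℝ :=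
  sInf {v : ℝ | ∃ (X : Matrix (Fin N) (Fin N) ℝ) (c : EuclideanSpace ℝ (Fin N)),
    X.PosDef ∧ K ⊆ ellipsoid X c ∧ v = volume.real (ellipsoid X c)}

/-- The volume of the minimal ellipsoid of the convex hull of the symmetrized frame, divided by
the volume of the unit ball. -/
noncomputable def volumeRatio {M N : ℕ} (φ : Fin M → EuclideanSpace ℝ (Fin N)) : ℝ :=
  minEllipsoidVolume (convexHull ℝ (symmetrized φ)) /
    volume.real (Metric.closedBall (0 : EuclideanSpace ℝ (Fin N)) 1)

end ScalableFrame

/-!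
The weights of an optimal scaling are tied to the minimal ellipsoid by duality. Let `c` maximise
`det (Φ C Φᵀ)` among nonnegative weights of mass `N`, and let `S` be the maximal `Φ C Φᵀ`. The
first-order condition `⟨φ i, S⁻¹ φ i⟩ ≤ 1` says that the ellipsoid of `S⁻¹` contains the frame, and
it is the smallest one that does, so that `V = √(det S)`.

* With `Q = √S` and `α = tr Q / N`, replacing `φ i` by `α Q⁻¹ φ i` on the support of `c` gives a
  scalable frame. Each replacement costs at most `‖Q - α‖² = N (1 - α²)`, where `α² ≥ V ^ (2 / N)`
  by AM-GM, and Carathéodory's theorem leaves at most `K` indices in the support.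
* If `∑ i, c i ψ i (ψ i)ᵀ = 1`, then weighting `φ i (φ i)ᵀ` by `c i ‖ψ i‖²` changes each summand by
  at most `√2 ‖φ i - ψ i‖`. With a support of size at most `K` this gives `D ≤ √(2 * K) d`, whereas
  `ω + √(ω² - D²) ≥ 2 √K`.
* If `A = Φ C' Φᵀ` is close to `1`, then the normalised eigenvalues of `A` have small variance,
  which forces their product, hence `det S`, to be large. This bounds `V` below in terms of `D`.
-/

namespace ScalableFrame

section ScalarInequalities

lemma mul_log_one_sub_le_log_one_sub_mul {s θ : ℝ} (hs : s < 1) (hθ₀ : 0 ≤ θ) (hθ₁ : θ ≤ 1) :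
    θ * Real.log (1 - s) ≤ Real.log (1 - θ * s) := by
  have h := strictConcaveOn_log_Ioi.concaveOn.2 (Set.mem_Ioi.2 (sub_pos.2 hs))
    (Set.mem_Ioi.2 zero_lt_one) hθ₀ (sub_nonneg.2 hθ₁) (add_sub_cancel θ 1)
  simp only [smul_eq_mul, Real.log_one, mul_zero, add_zero] at h
  rwa [show 1 - θ * s = θ * (1 - s) + (1 - θ) * 1 by ring]

lemma add_log_one_sub_sq_le_log_one_add {y : ℝ} (hy : y ^ 2 < 1) :
    y + Real.log (1 - y ^ 2) ≤ Real.log (1 + y) := by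
  obtain ⟨hy₁, hy₂⟩ := abs_lt.1 ((sq_lt_one_iff_abs_lt_one y).1 hy)
  have hlog : Real.log (1 - y) ≤ -y := by
    linarith [Real.log_le_sub_one_of_pos (sub_pos.2 hy₂)]
  have hfactor : Real.log (1 - y ^ 2) = Real.log (1 - y) + Real.log (1 + y) := by
    rw [← Real.log_mul (by linarith) (by linarith)]
    ring_nf
  linarith

lemma card_mul_sq_le_of_sum_eq_zero {ι : Type*} [Fintype ι] {y : ι → ℝ} (hy : ∑ i, y i = 0)
    (j : ι) : Fintype.card ι * y j ^ 2 ≤ (Fintype.card ι - 1) * ∑ i, y i ^ 2 := by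
  classical
  have hsum := Finset.add_sum_erase Finset.univ y (Finset.mem_univ j)
  have hsq := Finset.add_sum_erase Finset.univ (fun i => y i ^ 2) (Finset.mem_univ j)
  have hcauchy := sq_sum_le_card_mul_sum_sq (s := Finset.univ.erase j) (f := y)
  have hcard : ((Finset.univ.erase j).card : ℝ) = Fintype.card ι - 1 := by
    rw [Finset.cast_card_erase_of_mem (Finset.mem_univ j), Finset.card_univ]
  rw [hcard, show ∑ i ∈ Finset.univ.erase j, y i = -y j by linarith, neg_sq] at hcauchy
  rw [← hsq]
  linarith

lemma card_mul_log_one_sub_le_two_mul_sum_log {ι : Type*} [Fintype ι] {y : ι → ℝ}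
    (hcard : 3 ≤ Fintype.card ι) (hy : ∑ i, y i = 0) {s : ℝ} (hs : s < 1)
    (hys : (Fintype.card ι - 1) * ∑ i, y i ^ 2 = Fintype.card ι * s) :
    Fintype.card ι * Real.log (1 - s) ≤ 2 * ∑ i, Real.log (1 + y i) := by
  have hn : (3 : ℝ) ≤ Fintype.card ι := by exact_mod_cast hcard
  have hle : ∀ i, y i ^ 2 ≤ s := fun i =>
    le_of_mul_le_mul_left (hys ▸ card_mul_sq_le_of_sum_eq_zero hy i) (by linarith)
  have hsq : 0 ≤ ∑ i, y i ^ 2 := by positivity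
  have hs₀ : 0 ≤ s := by nlinarith
  have hlog : Real.log (1 - s) ≤ 0 := Real.log_nonpos (by linarith) (by linarith)
  have hterm : ∀ i, y i + y i ^ 2 / s * Real.log (1 - s) ≤ Real.log (1 + y i) := fun i => by
    have hconcave := mul_log_one_sub_le_log_one_sub_mul hs (div_nonneg (sq_nonneg (y i)) hs₀)
      (div_le_one_of_le₀ (hle i) hs₀)
    rw [div_mul_cancel_of_imp fun h => le_antisymm (h ▸ hle i) (sq_nonneg _)] at hconcave
    linarith [add_log_one_sub_sq_le_log_one_add ((hle i).trans_lt hs)]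
  have hweights : (∑ i, y i ^ 2) / s ≤ Fintype.card ι / 2 :=
    div_le_of_le_mul₀ hs₀ (by positivity) (by nlinarith [mul_nonneg (sub_nonneg.2 hn) hsq])
  calc Fintype.card ι * Real.log (1 - s)
      ≤ 2 * ((∑ i, y i ^ 2) / s * Real.log (1 - s)) := by
        linarith [mul_le_mul_of_nonpos_right hweights hlog]
    _ = 2 * ∑ i, (y i + y i ^ 2 / s * Real.log (1 - s)) := by
        rw [Finset.sum_add_distrib, hy, zero_add, ← Finset.sum_mul, Finset.sum_div]
    _ ≤ 2 * ∑ i, Real.log (1 + y i) := by gcongr; exact hterm _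

theorem one_sub_pow_card_le_prod_one_add_sq {ι : Type*} [Fintype ι] [Nonempty ι] {y : ι → ℝ}
    (hy : ∑ i, y i = 0) {s : ℝ} (hs : s < 1)
    (hys : (Fintype.card ι - 1) * ∑ i, y i ^ 2 = Fintype.card ι * s) :
    (1 - s) ^ Fintype.card ι ≤ (∏ i, (1 + y i)) ^ 2 := by
  classical
  obtain hcard | hcard | hcard :
      Fintype.card ι = 1 ∨ Fintype.card ι = 2 ∨ 3 ≤ Fintype.card ι := by
    have := Fintype.card_pos (α := ι)
    omega
  · obtain ⟨i, hi⟩ := Finset.card_eq_one.1 (Finset.card_univ.trans hcard)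
    rw [hi, Finset.sum_singleton] at hy
    simp only [hcard, Nat.cast_one, sub_self, zero_mul, one_mul] at hys
    simp [hi, hy, ← hys]
  · obtain ⟨i, j, hij, hu⟩ := Finset.card_eq_two.1 (Finset.card_univ.trans hcard)
    rw [hu, Finset.sum_pair hij] at hy hys
    rw [hu, Finset.prod_pair hij, hcard]
    norm_num [hcard] at hys
    rw [eq_neg_of_add_eq_zero_right hy] at hys ⊢
    rw [show s = y i ^ 2 by linarith]
    exact le_of_eq (by ring)
  · have hn : (0 : ℝ) < Fintype.card ι := by exact_mod_cast Fintype.card_pos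
    have hpos : ∀ i, 0 < 1 + y i := fun i => by
      have hle : y i ^ 2 ≤ s :=
        le_of_mul_le_mul_left (hys ▸ card_mul_sq_le_of_sum_eq_zero hy i) hn
      nlinarith
    have hprod : 0 < ∏ i, (1 + y i) := Finset.prod_pos fun i _ => hpos i
    rw [← Real.log_le_log_iff (pow_pos (sub_pos.2 hs) _) (pow_pos hprod 2), Real.log_pow,
      Real.log_pow, Real.log_prod fun i _ => (hpos i).ne']
    exact_mod_cast card_mul_log_one_sub_le_two_mul_sum_log hcard hy hs hys

lemma le_one_of_forall_one_add_mul_le_one_add_pow {n : ℕ} (hn : n ≠ 0) {g : ℝ}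
    (h : ∀ t > 0, 1 + n * t * g ≤ (1 + t) ^ n) : g ≤ 1 := by
  have hslope : ∀ t : ℝ, 0 < t → n * g ≤ ∑ k ∈ Finset.range n, (1 + t) ^ k := fun t ht => by
    have hgeom := geom_sum_mul (1 + t) n
    rw [add_sub_cancel_left] at hgeom
    exact le_of_mul_le_mul_right (by linarith [h t ht]) ht
  have hlim : Filter.Tendsto (fun t : ℝ => ∑ k ∈ Finset.range n, (1 + t) ^ k)
      (nhdsWithin 0 (Set.Ioi 0)) (nhds n) := by
    have hcont : Continuous fun t : ℝ => ∑ k ∈ Finset.range n, (1 + t) ^ k := by fun_prop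
    simpa using (hcont.tendsto 0).mono_left nhdsWithin_le_nhds
  have hle : n * g ≤ n := ge_of_tendsto hlim (eventually_mem_nhdsWithin.mono hslope)
  exact (mul_le_iff_le_one_right (by positivity)).1 hle

lemma div_add_add_sqrt_le {x k d : ℝ} (hx : 0 ≤ x) (hk : 0 < k) (h : x ≤ 2 * k * d) :
    x / ((x + k) + √((x + k) ^ 2 - x ^ 2)) ≤ d := by
  have hd : 0 ≤ d := nonneg_of_mul_nonneg_right (hx.trans h) (by positivity)
  have hsqrt : k ≤ √((x + k) ^ 2 - x ^ 2) := Real.le_sqrt_of_sq_le (by nlinarith)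
  rw [div_le_iff₀ (by positivity)]
  linarith [mul_le_mul_of_nonneg_left hsqrt hd, mul_nonneg hd hx]

end ScalarInequalities

section Caratheodory

variable {ι 𝕜 E : Type*} [Fintype ι] [Field 𝕜] [LinearOrder 𝕜] [IsStrictOrderedRing 𝕜]
  [AddCommGroup E] [Module 𝕜 E]

/- Move along the linear relation until the first weight vanishes. -/
lemma exists_nonneg_support_ssubset (w : ι → E) {c : ι → 𝕜} (hc : ∀ i, 0 ≤ c i)
    (hw : ¬LinearIndepOn 𝕜 w (Function.support c)) :
    ∃ c' : ι → 𝕜, (∀ i, 0 ≤ c' i) ∧ ∑ i, c' i • w i = ∑ i, c i • w i ∧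
      Function.support c' ⊂ Function.support c := by
  classical
  obtain ⟨f, hfc, hf, j, hj⟩ : ∃ f : ι → 𝕜, Function.support f ⊆ Function.support c ∧
      ∑ i, f i • w i = 0 ∧ ∃ j, 0 < f j := by
    rw [linearDepOn_iff] at hw
    obtain ⟨f, hfc, hf, hne⟩ := hw
    obtain ⟨j, hj⟩ := Finsupp.ne_iff.1 hne
    have hfs : Function.support f ⊆ Function.support c := by
      simpa [Finsupp.mem_supported] using hfc
    have hsum : ∑ i, f i • w i = 0 := by
      rwa [Finset.sum_subset (Finset.subset_univ _) fun i _ hi => by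
        simp [Finsupp.notMem_support_iff.1 hi]] at hf
    rcases lt_or_gt_of_ne hj with hneg | hpos
    · exact ⟨-f, by simpa using hfs, by simpa using hsum, j, by simpa using hneg⟩
    · exact ⟨f, hfs, hsum, j, hpos⟩
  obtain ⟨k, hk, hmin⟩ := Finset.exists_min_image (Finset.univ.filter fun i => 0 < f i)
    (fun i => c i / f i) ⟨j, by simpa using hj⟩
  have hfk : 0 < f k := (Finset.mem_filter.1 hk).2
  refine ⟨fun i => c i - c k / f k * f i, fun i => ?_, ?_, ?_⟩
  · rcases lt_or_ge 0 (f i) with hi | hi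
    · exact sub_nonneg.2 ((le_div_iff₀ hi).1 (hmin i (by simpa using hi)))
    · linarith [hc i, mul_nonpos_of_nonneg_of_nonpos (div_nonneg (hc k) hfk.le) hi]
  · simp only [sub_smul, Finset.sum_sub_distrib, mul_smul, ← Finset.smul_sum, hf, smul_zero,
      sub_zero]
  · refine (Set.ssubset_iff_of_subset fun i hi => ?_).2 ⟨k, hfc hfk.ne', by simp [hfk.ne']⟩
    by_contra hci
    have hfi : f i = 0 := Function.notMem_support.1 (mt (@hfc i) hci)
    exact hi (by simp [Function.notMem_support.1 hci, hfi])

theorem exists_nonneg_linearIndepOn_support (w : ι → E) {c : ι → 𝕜} (hc : ∀ i, 0 ≤ c i) :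
    ∃ c' : ι → 𝕜, (∀ i, 0 ≤ c' i) ∧ ∑ i, c' i • w i = ∑ i, c i • w i ∧
      LinearIndepOn 𝕜 w (Function.support c') := by
  induction hs : Function.support c using WellFoundedLT.induction generalizing c with
  | _ s ih =>
  subst hs
  by_cases hw : LinearIndepOn 𝕜 w (Function.support c)
  · exact ⟨c, hc, rfl, hw⟩
  · obtain ⟨c₁, hc₁, hsum, hlt⟩ := exists_nonneg_support_ssubset w hc hw
    obtain ⟨c', hc', hsum', hw'⟩ := ih _ hlt hc₁ rfl
    exact ⟨c', hc', hsum'.trans hsum, hw'⟩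

end Caratheodory

open Matrix

section Matrices

variable {n : Type*} [Fintype n]

open scoped MatrixOrder in
lemma exists_posDef_mul_self_eq {A : Matrix n n ℝ} (hA : A.PosDef) :
    ∃ Q : Matrix n n ℝ, Q.PosDef ∧ Q * Q = A := by
  classical
  exact ⟨CFC.sqrt A, hA.isStrictlyPositive.sqrt.posDef,
    CFC.sqrt_mul_sqrt_self A hA.posSemidef.nonneg⟩

open scoped MatrixOrder in
lemma exists_transpose_mul_self_eq {A : Matrix n n ℝ} (hA : A.PosSemidef) :
    ∃ Q : Matrix n n ℝ, Qᵀ * Q = A := by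
  classical
  obtain ⟨Q, hQ⟩ := CStarAlgebra.nonneg_iff_eq_star_mul_self.1 hA.nonneg
  exact ⟨Q, hQ.symm⟩

lemma eq_of_forall_dotProduct_mulVec_eq {A B : Matrix n n ℝ} (hA : A.IsHermitian)
    (hB : B.IsHermitian) (h : ∀ x, x ⬝ᵥ A *ᵥ x = x ⬝ᵥ B *ᵥ x) : A = B := by
  open scoped MatrixOrder in
  refine le_antisymm (PosSemidef.of_dotProduct_mulVec_nonneg (hB.sub hA) fun x => ?_)
    (PosSemidef.of_dotProduct_mulVec_nonneg (hA.sub hB) fun x => ?_) <;>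
  simp [sub_mulVec, dotProduct_sub, h]

variable [DecidableEq n]

lemma trace_mul_self_eq_sum_eigenvalues_sq {A : Matrix n n ℝ} (hA : A.IsHermitian) :
    (A * A).trace = ∑ i, hA.eigenvalues i ^ 2 := by
  conv_lhs => rw [hA.spectral_theorem, ← map_mul, Unitary.conjStarAlgAut_apply, trace_mul_cycle,
    Unitary.coe_star_mul_self, one_mul, diagonal_mul_diagonal, trace_diagonal]
  simp [sq]

lemma det_le_trace_div_card_pow [Nonempty n] {A : Matrix n n ℝ} (hA : A.PosSemidef) :
    A.det ≤ (A.trace / Fintype.card n) ^ Fintype.card n := by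
  have hprod : 0 ≤ ∏ i, hA.1.eigenvalues i :=
    Finset.prod_nonneg fun i _ => hA.eigenvalues_nonneg i
  have hamgm := Real.geom_mean_le_arith_mean Finset.univ (fun _ => 1) hA.1.eigenvalues
    (fun _ _ => zero_le_one) (by simp [Fintype.card_pos]) fun i _ => hA.eigenvalues_nonneg i
  simp only [Real.rpow_one, one_mul, Finset.sum_const, Finset.card_univ, nsmul_eq_mul,
    mul_one] at hamgm
  calc A.det
      = ((∏ i, hA.1.eigenvalues i) ^ (Fintype.card n : ℝ)⁻¹) ^ Fintype.card n := by
        rw [Real.rpow_inv_natCast_pow hprod Fintype.card_ne_zero, hA.1.det_eq_prod_eigenvalues]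
        rfl
    _ ≤ (A.trace / Fintype.card n) ^ Fintype.card n := by
        rw [hA.1.trace_eq_sum_eigenvalues]
        exact pow_le_pow_left₀ (Real.rpow_nonneg hprod _) hamgm _

lemma det_mul_det_le_one [Nonempty n] {X S : Matrix n n ℝ} (hX : X.PosDef) (hS : S.PosSemidef)
    (htr : (X * S).trace ≤ Fintype.card n) : X.det * S.det ≤ 1 := by
  obtain ⟨Q, hQ, rfl⟩ := exists_posDef_mul_self_eq hX
  have hpsd : (Q * S * Q).PosSemidef := by
    simpa only [hQ.1.eq] using hS.mul_mul_conjTranspose_same Q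
  have htr' : (Q * S * Q).trace ≤ Fintype.card n := by
    rwa [trace_mul_comm, ← Matrix.mul_assoc]
  calc (Q * Q).det * S.det = (Q * S * Q).det := by simp only [det_mul]; ring
    _ ≤ ((Q * S * Q).trace / Fintype.card n) ^ Fintype.card n := det_le_trace_div_card_pow hpsd
    _ ≤ 1 := pow_le_one₀ (div_nonneg hpsd.trace_nonneg (Nat.cast_nonneg _))
        (div_le_one_of_le₀ htr' (Nat.cast_nonneg _))

lemma one_sub_pow_card_le_det_smul_sq [Nonempty n] {A : Matrix n n ℝ} (hA : A.IsHermitian)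
    (htr : A.trace ≠ 0) {s : ℝ} (hs : s < 1)
    (hsA : s = (Fintype.card n - 1) * (Fintype.card n * (A * A).trace / A.trace ^ 2 - 1)) :
    (1 - s) ^ Fintype.card n ≤ ((Fintype.card n / A.trace) • A).det ^ 2 := by
  set a : ℝ := Fintype.card n / A.trace with ha
  have htrace : ∑ i, hA.eigenvalues i = A.trace := hA.trace_eq_sum_eigenvalues.symm
  have hsum : ∑ i, (a * hA.eigenvalues i - 1) = 0 := by
    rw [Finset.sum_sub_distrib, ← Finset.mul_sum, htrace, ha, div_mul_cancel₀ _ htr]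
    simp
  have hsq : ∑ i, (a * hA.eigenvalues i - 1) ^ 2 =
      Fintype.card n * (Fintype.card n * (A * A).trace / A.trace ^ 2 - 1) := by
    calc ∑ i, (a * hA.eigenvalues i - 1) ^ 2
        = ∑ i, (a ^ 2 * hA.eigenvalues i ^ 2 - 2 * a * hA.eigenvalues i + 1) := by
          refine Finset.sum_congr rfl fun i _ => ?_
          ring
      _ = a ^ 2 * (A * A).trace - 2 * a * A.trace + Fintype.card n := by
          simp [Finset.sum_add_distrib, Finset.sum_sub_distrib, ← Finset.mul_sum, htrace,
            trace_mul_self_eq_sum_eigenvalues_sq hA]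
      _ = _ := by
          rw [ha]
          field_simp
          ring
  have hdet : (a • A).det = ∏ i, (1 + (a * hA.eigenvalues i - 1)) := by
    simp [hA.det_eq_prod_eigenvalues, Finset.prod_mul_distrib]
  rw [hdet]
  refine one_sub_pow_card_le_prod_one_add_sq hsum hs ?_
  rw [hsq, hsA]
  ring

lemma det_add_smul_vecMulVec {A : Matrix n n ℝ} (hA : IsUnit A.det) (t : ℝ) (u v : n → ℝ) :
    (A + t • vecMulVec u v).det = A.det * (1 + t * (v ⬝ᵥ A⁻¹ *ᵥ u)) := by
  rw [← smul_vecMulVec, vecMulVec_eq Unit, det_add_replicateCol_mul_replicateRow hA,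
    Matrix.mul_assoc, ← replicateCol_mulVec, det_unique (n := Unit), Matrix.add_apply,
    one_apply_eq, replicateRow_mul_replicateCol_apply, mulVec_smul, dotProduct_smul, smul_eq_mul]

end Matrices

section FrobeniusNorm

open scoped Matrix.Norms.Frobenius

variable {m n : Type*} [Fintype m] [Fintype n]

lemma frobenius_norm_sq (A : Matrix m n ℝ) : ‖A‖ ^ 2 = ∑ i, ∑ j, A i j ^ 2 := by
  have h : 0 ≤ ∑ i, ∑ j, ‖A i j‖ ^ (2 : ℝ) := by positivity
  rw [frobenius_norm_def, ← Real.sqrt_eq_rpow, Real.sq_sqrt h]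
  simp

lemma frobenius_norm_sq_eq_trace (A : Matrix m n ℝ) : ‖A‖ ^ 2 = (Aᵀ * A).trace := by
  rw [frobenius_norm_sq, Finset.sum_comm]
  simp [trace, mul_apply, sq]

lemma norm_sq_toEuclideanLin_le [DecidableEq n] (A : Matrix m n ℝ) (x : EuclideanSpace ℝ n) :
    ‖A.toEuclideanLin x‖ ^ 2 ≤ ‖A‖ ^ 2 * ‖x‖ ^ 2 := by
  rw [frobenius_norm_sq, EuclideanSpace.norm_sq_eq, EuclideanSpace.norm_sq_eq, Finset.sum_mul]
  refine Finset.sum_le_sum fun i _ => ?_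
  simpa [mulVec, dotProduct] using Finset.sum_mul_sq_le_sq_mul_sq Finset.univ (A i) x.ofLp

lemma norm_sub_smul_one_sq [DecidableEq n] {A : Matrix n n ℝ} (hA : A.IsHermitian) (t : ℝ) :
    ‖A - t • 1‖ ^ 2 = (A * A).trace - 2 * t * A.trace + t ^ 2 * Fintype.card n := by
  rw [frobenius_norm_sq_eq_trace]
  simp only [transpose_sub, (isHermitian_iff_isSymm.1 hA).eq, transpose_smul, transpose_one,
    sub_mul, mul_sub, smul_one_mul, mul_smul_one, trace_sub, trace_smul, trace_one, smul_eq_mul]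
  ring

lemma trace_pos_of_norm_sub_one_sq_lt_one [DecidableEq n] [Nonempty n] {A : Matrix n n ℝ}
    (hA : A.IsHermitian) (h : ‖A - 1‖ ^ 2 < 1) : 0 < A.trace := by
  have hn : (1 : ℝ) ≤ Fintype.card n := by exact_mod_cast Fintype.card_pos
  have hnorm := norm_sub_smul_one_sq hA 1
  have hsq : 0 ≤ (A * A).trace := by
    rw [trace_mul_self_eq_sum_eigenvalues_sq hA]
    positivity
  rw [one_smul] at hnorm
  linarith

lemma trace_mul_self_mul_le_trace_sq [DecidableEq n] {A : Matrix n n ℝ} (hA : A.IsHermitian) :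
    (A * A).trace * (Fintype.card n - ‖A - 1‖ ^ 2) ≤ A.trace ^ 2 := by
  have hnorm := norm_sub_smul_one_sq hA 1
  rw [one_smul] at hnorm
  rw [hnorm]
  linarith [sq_nonneg ((A * A).trace - A.trace)]

lemma div_pow_card_le_det_smul_sq [DecidableEq n] [Nonempty n] {A : Matrix n n ℝ}
    (hA : A.IsHermitian) {r : ℝ} (hr : ‖A - 1‖ ^ 2 = r) (hr₁ : r < 1) :
    (Fintype.card n * (1 - r) / (Fintype.card n - r)) ^ Fintype.card n ≤
      ((Fintype.card n / A.trace) • A).det ^ 2 := by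
  have hn : (1 : ℝ) ≤ Fintype.card n := by exact_mod_cast Fintype.card_pos
  have hnr : 0 < Fintype.card n - r := by linarith
  have htr : 0 < A.trace := trace_pos_of_norm_sub_one_sq_lt_one hA (hr ▸ hr₁)
  have hratio : (A * A).trace / A.trace ^ 2 ≤ 1 / (Fintype.card n - r) := by
    rw [div_le_div_iff₀ (by positivity) hnr, one_mul, ← hr]
    exact trace_mul_self_mul_le_trace_sq hA
  have hbase : Fintype.card n * (1 - r) / (Fintype.card n - r) ≤
      1 - (Fintype.card n - 1) * (Fintype.card n * (A * A).trace / A.trace ^ 2 - 1) := by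
    rw [mul_div_assoc _ (A * A).trace,
      show Fintype.card n * (1 - r) / (Fintype.card n - r) = Fintype.card n -
        (Fintype.card n - 1) * Fintype.card n * (1 / (Fintype.card n - r)) by field_simp; ring]
    linarith [mul_le_mul_of_nonneg_left hratio
      (mul_nonneg (sub_nonneg.2 hn) (zero_le_one.trans hn))]
  have hpos : 0 < Fintype.card n * (1 - r) / (Fintype.card n - r) :=
    div_pos (mul_pos (by linarith) (by linarith)) hnr
  exact (pow_le_pow_left₀ hpos.le hbase _).trans
    (one_sub_pow_card_le_det_smul_sq hA htr.ne' (by linarith) rfl)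

end FrobeniusNorm

section FrameOperator

variable {ι n : Type*} [Fintype ι]

/-- The matrix `Φ C Φᵀ`, where `Φ` has columns `φ i` and `C` is the diagonal matrix of the weights
`c`, written as the sum of the rank-one matrices `c i • φ i (φ i)ᵀ`. -/
noncomputable def weightedFrameOp (φ : ι → EuclideanSpace ℝ n) (c : ι → ℝ) : Matrix n n ℝ :=
  ∑ i, c i • vecMulVec (φ i).ofLp (φ i).ofLp

lemma weightedFrameOp_apply (φ : ι → EuclideanSpace ℝ n) (c : ι → ℝ) (a b : n) :
    weightedFrameOp φ c a b = ∑ i, c i * (φ i a * φ i b) := by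
  simp [weightedFrameOp, Matrix.sum_apply, vecMulVec_apply]

lemma frameMatrix_mul_diagonal_mul_transpose {M N : ℕ} (φ : Fin M → EuclideanSpace ℝ (Fin N))
    (c : Fin M → ℝ) :
    frameMatrix φ * diagonal c * (frameMatrix φ)ᵀ = weightedFrameOp φ c := by
  ext a b
  rw [mul_apply, weightedFrameOp_apply]
  simp only [mul_diagonal, transpose_apply, frameMatrix, of_apply]
  exact Finset.sum_congr rfl fun i _ => by ring

lemma weightedFrameOp_smul (φ : ι → EuclideanSpace ℝ n) (c : ι → ℝ) (t : ℝ) :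
    weightedFrameOp φ (t • c) = t • weightedFrameOp φ c := by
  simp [weightedFrameOp, Finset.smul_sum, mul_smul]

lemma weightedFrameOp_add_single [DecidableEq ι] (φ : ι → EuclideanSpace ℝ n) (c : ι → ℝ)
    (i : ι) (t : ℝ) :
    weightedFrameOp φ (c + Pi.single i t) =
      weightedFrameOp φ c + t • vecMulVec (φ i).ofLp (φ i).ofLp := by
  simp [weightedFrameOp, add_smul, Finset.sum_add_distrib, Pi.single_apply]

lemma posSemidef_weightedFrameOp [Finite n] (φ : ι → EuclideanSpace ℝ n) {c : ι → ℝ}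
    (hc : ∀ i, 0 ≤ c i) : (weightedFrameOp φ c).PosSemidef :=
  posSemidef_sum _ fun i _ => (posSemidef_vecMulVec_self_star (φ i).ofLp).smul (hc i)

lemma isHermitian_weightedFrameOp (φ : ι → EuclideanSpace ℝ n) (c : ι → ℝ) :
    (weightedFrameOp φ c).IsHermitian := by
  refine isHermitian_iff_isSymm.2 ?_
  ext a b
  simp only [transpose_apply, weightedFrameOp_apply, mul_comm (φ _ b)]

variable [Fintype n]

lemma inner_eq_dotProduct (x y : EuclideanSpace ℝ n) : inner ℝ x y = x.ofLp ⬝ᵥ y.ofLp := by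
  rw [EuclideanSpace.inner_eq_star_dotProduct, star_trivial, dotProduct_comm]

lemma dotProduct_self_eq_norm_sq (x : EuclideanSpace ℝ n) : x.ofLp ⬝ᵥ x.ofLp = ‖x‖ ^ 2 := by
  rw [← inner_eq_dotProduct, real_inner_self_eq_norm_sq]

lemma trace_mul_weightedFrameOp (X : Matrix n n ℝ) (φ : ι → EuclideanSpace ℝ n) (c : ι → ℝ) :
    (X * weightedFrameOp φ c).trace = ∑ i, c i * ((φ i).ofLp ⬝ᵥ X *ᵥ (φ i).ofLp) := by
  simp [weightedFrameOp, Matrix.mul_sum, mul_vecMulVec, trace_sum, trace_vecMulVec,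
    dotProduct_comm]

lemma trace_weightedFrameOp {φ : ι → EuclideanSpace ℝ n} (hφ : ∀ i, ‖φ i‖ = 1) (c : ι → ℝ) :
    (weightedFrameOp φ c).trace = ∑ i, c i := by
  simp [weightedFrameOp, trace_sum, dotProduct_self_eq_norm_sq, hφ]

lemma dotProduct_weightedFrameOp_mulVec (φ : ι → EuclideanSpace ℝ n) (c : ι → ℝ)
    (x : EuclideanSpace ℝ n) :
    x.ofLp ⬝ᵥ weightedFrameOp φ c *ᵥ x.ofLp = ∑ i, c i * (inner ℝ x (φ i)) ^ 2 := by
  simp only [weightedFrameOp, sum_mulVec, dotProduct_sum, smul_mulVec, vecMulVec_mulVec,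
    dotProduct_smul, inner_eq_dotProduct]
  exact Finset.sum_congr rfl fun i _ => by simp [sq, dotProduct_comm]

lemma mul_weightedFrameOp_mul_transpose [DecidableEq n] (X : Matrix n n ℝ)
    (φ : ι → EuclideanSpace ℝ n) (c : ι → ℝ) :
    X * weightedFrameOp φ c * Xᵀ = weightedFrameOp (fun i => X.toEuclideanLin (φ i)) c := by
  simp [weightedFrameOp, Matrix.mul_sum, Matrix.sum_mul, mul_vecMulVec, vecMulVec_mul,
    vecMul_transpose]

lemma continuous_det_weightedFrameOp [DecidableEq n] (φ : ι → EuclideanSpace ℝ n) :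
    Continuous fun c => (weightedFrameOp φ c).det := by
  unfold weightedFrameOp
  fun_prop

lemma IsFrame.posDef_weightedFrameOp_one {M N : ℕ} {φ : Fin M → EuclideanSpace ℝ (Fin N)}
    (hφ : IsFrame φ) : (weightedFrameOp φ 1).PosDef := by
  obtain ⟨A, B, hA, -, hAB⟩ := hφ
  refine PosDef.of_dotProduct_mulVec_pos (isHermitian_weightedFrameOp φ 1) fun x hx => ?_
  have hquad := dotProduct_weightedFrameOp_mulVec φ 1 (WithLp.toLp 2 x)
  simp only [Pi.one_apply, one_mul] at hquad
  rw [star_trivial, hquad]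
  have hnorm : 0 < ‖WithLp.toLp 2 x‖ := by simpa using hx
  exact (by positivity : 0 < A * ‖WithLp.toLp 2 x‖ ^ 2).trans_le (hAB _).1

end FrameOperator

section DOptimal

variable {ι n : Type*} [Fintype ι] [Fintype n] [DecidableEq n]

/-- The weights `c` form a D-optimal design for `φ`: they maximise the determinant of the frame
operator among nonnegative weights of total mass `card n`, the mass that weights with frame
operator `1` have when the vectors are normalised. This is the dual problem to minimising the
volume of a centred ellipsoid that contains `φ`. -/
structure IsDOptimal (φ : ι → EuclideanSpace ℝ n) (c : ι → ℝ) : Prop where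
  nonneg : ∀ i, 0 ≤ c i
  sum_eq : ∑ i, c i = Fintype.card n
  det_le : ∀ c' : ι → ℝ, (∀ i, 0 ≤ c' i) → ∑ i, c' i = Fintype.card n →
    (weightedFrameOp φ c').det ≤ (weightedFrameOp φ c).det

theorem exists_isDOptimal [Nonempty ι] (φ : ι → EuclideanSpace ℝ n) : ∃ c, IsDOptimal φ c := by
  classical
  have hcompact : IsCompact (Set.Icc (0 : ι → ℝ) (fun _ => Fintype.card n) ∩
      {c | ∑ i, c i = Fintype.card n}) :=
    isCompact_Icc.inter_right (isClosed_eq (by fun_prop) continuous_const)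
  have hmem : ∀ c : ι → ℝ, (∀ i, 0 ≤ c i) → ∑ i, c i = Fintype.card n →
      c ∈ Set.Icc (0 : ι → ℝ) (fun _ => Fintype.card n) ∩ {c | ∑ i, c i = Fintype.card n} :=
    fun c hc hsum => ⟨⟨hc, fun i => hsum ▸
      Finset.single_le_sum (fun j _ => hc j) (Finset.mem_univ i)⟩, hsum⟩
  obtain ⟨c, hc, hmax⟩ := hcompact.exists_isMaxOn
    ⟨Pi.single (Classical.arbitrary ι) (Fintype.card n : ℝ), hmem _
      (show (0 : ι → ℝ) ≤ _ from Pi.single_nonneg.2 (Nat.cast_nonneg _)) (by simp)⟩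
    (continuous_det_weightedFrameOp φ).continuousOn
  exact ⟨c, hc.1.1, hc.2, fun c' hc' hsum => hmax (hmem c' hc' hsum)⟩

namespace IsDOptimal

variable {φ : ι → EuclideanSpace ℝ n} {c : ι → ℝ}

lemma det_smul_le (hc : IsDOptimal φ c) {c' : ι → ℝ} (hc' : ∀ i, 0 ≤ c' i)
    (hsum : 0 < ∑ i, c' i) :
    ((Fintype.card n / ∑ i, c' i) • weightedFrameOp φ c').det ≤ (weightedFrameOp φ c).det := by
  rw [← weightedFrameOp_smul]
  refine hc.det_le _ (fun i => mul_nonneg (by positivity) (hc' i)) ?_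
  simp [← Finset.mul_sum, hsum.ne']

lemma posDef [Nonempty ι] [Nonempty n] (hc : IsDOptimal φ c)
    (hφ : (weightedFrameOp φ 1).PosDef) : (weightedFrameOp φ c).PosDef := by
  refine (posSemidef_weightedFrameOp φ hc.nonneg).posDef_iff_det_ne_zero.2 (ne_of_gt ?_)
  have hsum : 0 < ∑ i : ι, (1 : ι → ℝ) i := by simp [Fintype.card_pos]
  have hn : (0 : ℝ) < Fintype.card n := by exact_mod_cast Fintype.card_pos
  refine lt_of_lt_of_le ?_ (hc.det_smul_le (c' := 1) (fun _ => zero_le_one) hsum)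
  rw [det_smul]
  exact mul_pos (pow_pos (div_pos hn hsum) _) hφ.det_pos

/- First-order optimality: no growth of `det` when mass is moved towards the `i`-th vector. -/
theorem dotProduct_inv_mulVec_le_one [Nonempty n] (hc : IsDOptimal φ c)
    (hS : (weightedFrameOp φ c).PosDef) (i : ι) :
    (φ i).ofLp ⬝ᵥ (weightedFrameOp φ c)⁻¹ *ᵥ (φ i).ofLp ≤ 1 := by
  classical
  refine le_one_of_forall_one_add_mul_le_one_add_pow (n := Fintype.card n) Fintype.card_ne_zero
    fun t ht => ?_
  have hcard : (0 : ℝ) < Fintype.card n := by exact_mod_cast Fintype.card_pos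
  have hsum : ∑ j, (c + Pi.single i (Fintype.card n * t) : ι → ℝ) j = Fintype.card n * (1 + t) := by
    simp [Finset.sum_add_distrib, hc.sum_eq, mul_add]
  have hmax := hc.det_smul_le (c' := c + Pi.single i (Fintype.card n * t))
    (show 0 ≤ c + _ from add_nonneg hc.nonneg (Pi.single_nonneg.2 (by positivity)))
    (by rw [hsum]; positivity)
  rw [hsum, div_mul_cancel_left₀ hcard.ne', weightedFrameOp_add_single, det_smul,
    det_add_smul_vecMulVec hS.det_pos.ne'.isUnit, inv_pow,
    inv_mul_le_iff₀ (by positivity), mul_comm (_ ^ _)] at hmax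
  exact le_of_mul_le_mul_left hmax hS.det_pos

lemma det_le_one [Nonempty n] (hc : IsDOptimal φ c) (hφ : ∀ i, ‖φ i‖ = 1) :
    (weightedFrameOp φ c).det ≤ 1 := by
  simpa [trace_weightedFrameOp hφ, hc.sum_eq] using
    det_le_trace_div_card_pow (posSemidef_weightedFrameOp φ hc.nonneg)

open scoped Matrix.Norms.Frobenius in
theorem card_mul_one_sub_le [Nonempty n] (hc : IsDOptimal φ c) (hφ : ∀ i, ‖φ i‖ = 1) {v : ℝ}
    (hv : 0 ≤ v) (hvS : v ^ Fintype.card n = (weightedFrameOp φ c).det ^ 2) {c' : ι → ℝ}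
    (hc' : ∀ i, 0 ≤ c' i) :
    Fintype.card n * (1 - v) ≤ ‖weightedFrameOp φ c' - 1‖ ^ 2 * (Fintype.card n - v) := by
  have hn : (1 : ℝ) ≤ Fintype.card n := by exact_mod_cast Fintype.card_pos
  have hS' := posSemidef_weightedFrameOp φ hc'
  rcases le_or_gt 1 (‖weightedFrameOp φ c' - 1‖ ^ 2) with hr | hr
  · have hv₁ : v ≤ 1 := by
      rw [← pow_le_one_iff_of_nonneg hv (Fintype.card_ne_zero (α := n)), hvS]
      exact pow_le_one₀ (posSemidef_weightedFrameOp φ hc.nonneg).det_nonneg (hc.det_le_one hφ)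
    linarith [mul_le_mul_of_nonneg_right hr (sub_nonneg.2 (hv₁.trans hn)),
      mul_nonneg (sub_nonneg.2 hn) hv]
  · have htr := trace_pos_of_norm_sub_one_sq_lt_one hS'.1 hr
    have hdet := div_pow_card_le_det_smul_sq hS'.1 rfl hr
    rw [trace_weightedFrameOp hφ] at htr hdet
    have hmax := pow_le_pow_left₀ (hS'.smul (by positivity)).det_nonneg
      (hc.det_smul_le hc' htr) 2
    have hle := le_of_pow_le_pow_left₀ Fintype.card_ne_zero hv ((hdet.trans hmax).trans_eq hvS.symm)
    rw [div_le_iff₀ (by linarith)] at hle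
    linarith

end IsDOptimal

end DOptimal

section Volume

open MeasureTheory

lemma inner_toEuclideanLin {n : Type*} [Fintype n] [DecidableEq n] (X : Matrix n n ℝ)
    (x : EuclideanSpace ℝ n) : inner ℝ (X.toEuclideanLin x) x = x.ofLp ⬝ᵥ X *ᵥ x.ofLp := by
  rw [inner_eq_dotProduct, dotProduct_comm, toLpLin_apply]

lemma norm_sq_toEuclideanLin {m n : Type*} [Fintype m] [Fintype n] [DecidableEq n]
    (Q : Matrix m n ℝ) (x : EuclideanSpace ℝ n) :
    ‖Q.toEuclideanLin x‖ ^ 2 = x.ofLp ⬝ᵥ (Qᵀ * Q) *ᵥ x.ofLp := by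
  rw [← dotProduct_self_eq_norm_sq, toLpLin_apply, ← mulVec_mulVec,
    dotProduct_mulVec x.ofLp, vecMul_transpose]

variable {M N : ℕ}

lemma ellipsoid_transpose_mul_self (Q : Matrix (Fin N) (Fin N) ℝ) (e : EuclideanSpace ℝ (Fin N)) :
    ellipsoid (Qᵀ * Q) e =
      (fun v => v + -e) ⁻¹' (Q.toEuclideanLin ⁻¹' Metric.closedBall 0 1) := by
  ext v
  rw [ellipsoid, Set.mem_ofPred_eq, inner_toEuclideanLin, ← norm_sq_toEuclideanLin]
  simp [sub_eq_add_neg]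

lemma convex_ellipsoid {X : Matrix (Fin N) (Fin N) ℝ} (hX : X.PosSemidef)
    (e : EuclideanSpace ℝ (Fin N)) : Convex ℝ (ellipsoid X e) := by
  obtain ⟨Q, rfl⟩ := exists_transpose_mul_self_eq hX
  rw [ellipsoid_transpose_mul_self]
  exact ((convex_closedBall 0 1).linear_preimage _).translate_preimage_left _

lemma volume_ellipsoid {X : Matrix (Fin N) (Fin N) ℝ} (hX : X.PosDef)
    (e : EuclideanSpace ℝ (Fin N)) :
    volume.real (ellipsoid X e) =
      (√X.det)⁻¹ * volume.real (Metric.closedBall (0 : EuclideanSpace ℝ (Fin N)) 1) := by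
  obtain ⟨Q, rfl⟩ := exists_transpose_mul_self_eq hX.posSemidef
  have hdetX : (Qᵀ * Q).det = Q.det ^ 2 := by rw [det_mul, det_transpose, sq]
  have hdet : LinearMap.det Q.toEuclideanLin = Q.det := by
    rw [toEuclideanLin_eq_toLin_orthonormal, LinearMap.det_toLin]
  have hne : Q.det ≠ 0 := ne_zero_pow two_ne_zero (hdetX ▸ hX.det_pos.ne')
  rw [ellipsoid_transpose_mul_self, measureReal_def, measure_preimage_add_right,
    Measure.addHaar_preimage_linearMap _ (hdet ▸ hne), ENNReal.toReal_mul,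
    ENNReal.toReal_ofReal (abs_nonneg _), hdet, hdetX, Real.sqrt_sq_eq_abs, abs_inv,
    measureReal_def]

/- By the parallelogram law, moving the centre to the origin does not lose a symmetric pair. -/
lemma dotProduct_mulVec_le_one_of_mem_ellipsoid {X : Matrix (Fin N) (Fin N) ℝ}
    (hX : X.PosSemidef) {x e : EuclideanSpace ℝ (Fin N)} (hx : x ∈ ellipsoid X e)
    (hx' : -x ∈ ellipsoid X e) : x.ofLp ⬝ᵥ X *ᵥ x.ofLp ≤ 1 := by
  have he := hX.dotProduct_mulVec_nonneg e.ofLp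
  rw [ellipsoid, Set.mem_ofPred_eq, inner_toEuclideanLin] at hx hx'
  simp only [WithLp.ofLp_sub, WithLp.ofLp_neg, mulVec_sub, mulVec_neg, dotProduct_sub,
    sub_dotProduct, neg_dotProduct, dotProduct_neg, star_trivial] at hx hx' he
  linarith

lemma convexHull_symmetrized_subset_ellipsoid {φ : Fin M → EuclideanSpace ℝ (Fin N)}
    {X : Matrix (Fin N) (Fin N) ℝ} (hX : X.PosSemidef)
    (hφ : ∀ i, (φ i).ofLp ⬝ᵥ X *ᵥ (φ i).ofLp ≤ 1) :
    convexHull ℝ (symmetrized φ) ⊆ ellipsoid X 0 := by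
  refine convexHull_min ?_ (convex_ellipsoid hX 0)
  rintro _ (⟨i, rfl⟩ | ⟨i, rfl⟩)
  · simpa [ellipsoid, inner_toEuclideanLin] using hφ i
  · simpa [ellipsoid, inner_toEuclideanLin, mulVec_neg] using hφ i

lemma sqrt_det_mul_volume_le_volume_ellipsoid [Nonempty (Fin N)]
    {φ : Fin M → EuclideanSpace ℝ (Fin N)} {c : Fin M → ℝ} (hc : ∀ i, 0 ≤ c i)
    (hsum : ∑ i, c i ≤ N) {X : Matrix (Fin N) (Fin N) ℝ} (hX : X.PosDef)
    {e : EuclideanSpace ℝ (Fin N)} (hφ : symmetrized φ ⊆ ellipsoid X e) :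
    √(weightedFrameOp φ c).det * volume.real (Metric.closedBall (0 : EuclideanSpace ℝ (Fin N)) 1) ≤
      volume.real (ellipsoid X e) := by
  have htr : (X * weightedFrameOp φ c).trace ≤ Fintype.card (Fin N) := by
    rw [trace_mul_weightedFrameOp, Fintype.card_fin]
    refine (Finset.sum_le_sum fun i _ => mul_le_of_le_one_right (hc i) ?_).trans hsum
    exact dotProduct_mulVec_le_one_of_mem_ellipsoid hX.posSemidef (hφ (Or.inl ⟨i, rfl⟩))
      (hφ (Or.inr ⟨i, rfl⟩))
  have hdet := det_mul_det_le_one hX (posSemidef_weightedFrameOp φ hc) htr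
  rw [volume_ellipsoid hX, ← Real.sqrt_inv]
  refine mul_le_mul_of_nonneg_right (Real.sqrt_le_sqrt ?_) measureReal_nonneg
  rwa [← one_div, le_div_iff₀' hX.det_pos]

theorem IsDOptimal.volumeRatio_eq_sqrt_det [Nonempty (Fin N)]
    {φ : Fin M → EuclideanSpace ℝ (Fin N)} {c : Fin M → ℝ} (hc : IsDOptimal φ c)
    (hS : (weightedFrameOp φ c).PosDef) : volumeRatio φ = √(weightedFrameOp φ c).det := by
  have hball : volume.real (Metric.closedBall (0 : EuclideanSpace ℝ (Fin N)) 1) ≠ 0 :=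
    (ENNReal.toReal_pos (Metric.measure_closedBall_pos _ _ one_pos).ne'
      measure_closedBall_lt_top.ne).ne'
  have hleast : IsLeast {v : ℝ | ∃ (X : Matrix (Fin N) (Fin N) ℝ) (e : EuclideanSpace ℝ (Fin N)),
      X.PosDef ∧ convexHull ℝ (symmetrized φ) ⊆ ellipsoid X e ∧ v = volume.real (ellipsoid X e)}
      (√(weightedFrameOp φ c).det *
        volume.real (Metric.closedBall (0 : EuclideanSpace ℝ (Fin N)) 1)) := by
    refine ⟨⟨_, 0, hS.inv, convexHull_symmetrized_subset_ellipsoid hS.inv.posSemidef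
      (hc.dotProduct_inv_mulVec_le_one hS), ?_⟩, ?_⟩
    · rw [volume_ellipsoid hS.inv, det_nonsing_inv, Ring.inverse_eq_inv', Real.sqrt_inv, inv_inv]
    · rintro _ ⟨X, e, hX, hφ, rfl⟩
      exact sqrt_det_mul_volume_le_volume_ellipsoid hc.nonneg
        (hc.sum_eq.trans_le (by simp)) hX ((subset_convexHull ℝ _).trans hφ)
  rw [volumeRatio, minEllipsoidVolume, hleast.csInf_eq, mul_div_cancel_right₀ _ hball]

end Volume

section SparseWeights

/-- The number `min M (N (N + 1) / 2)`, denoted `K` in the informal statement: an upper bound for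
the number of vectors needed to represent a frame operator. -/
noncomputable def sparsityBound (M N : ℕ) : ℝ :=
  min (M : ℝ) ((N : ℝ) * ((N : ℝ) + 1) / 2)

variable {M N : ℕ}

lemma sparsityBound_pos [Nonempty (Fin M)] [Nonempty (Fin N)] : 0 < sparsityBound M N := by
  have hM : 0 < M := Fin.pos_iff_nonempty.2 ‹_›
  have hN : 0 < N := Fin.pos_iff_nonempty.2 ‹_›
  exact lt_min (by exact_mod_cast hM) (by positivity)

/- Carathéodory's theorem in the space of symmetric matrices, realised as functions on `Sym2`. -/
theorem exists_sparse_weights (φ : Fin M → EuclideanSpace ℝ (Fin N)) {c : Fin M → ℝ}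
    (hc : ∀ i, 0 ≤ c i) : ∃ c' : Fin M → ℝ, (∀ i, 0 ≤ c' i) ∧
      weightedFrameOp φ c' = weightedFrameOp φ c ∧
      ((Finset.univ.filter fun i => c' i ≠ 0).card : ℝ) ≤ sparsityBound M N := by
  obtain ⟨c', hc', hsum, hindep⟩ := exists_nonneg_linearIndepOn_support
    (fun i (z : Sym2 (Fin N)) => Sym2.mul (z.map (φ i).ofLp)) hc
  refine ⟨c', hc', ?_, le_min ?_ ?_⟩
  · ext a b
    simpa [weightedFrameOp_apply] using congrFun hsum s(a, b)
  · exact_mod_cast (Finset.card_le_univ _).trans_eq (Fintype.card_fin M)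
  · have hcard := LinearIndependent.fintype_card_le_finrank (R := ℝ)
      (show LinearIndependent ℝ fun i : {i // c' i ≠ 0} => _ from hindep)
    rw [Fintype.card_subtype, Module.finrank_fintype_fun_eq_card, Sym2.card, Fintype.card_fin,
      ← Nat.cast_le (α := ℝ), Nat.cast_choose_two, Nat.cast_add_one] at hcard
    linarith

end SparseWeights

section Scalable

variable {M N : ℕ}

lemma weightedFrameOp_eq_one_iff (ψ : Fin M → EuclideanSpace ℝ (Fin N)) (c : Fin M → ℝ) :
    weightedFrameOp ψ c = 1 ↔
      ∀ x : EuclideanSpace ℝ (Fin N), ∑ i, c i * (inner ℝ x (ψ i)) ^ 2 = ‖x‖ ^ 2 := by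
  refine ⟨fun h x => ?_, fun h => ?_⟩
  · rw [← dotProduct_weightedFrameOp_mulVec, h, one_mulVec, dotProduct_self_eq_norm_sq]
  · refine eq_of_forall_dotProduct_mulVec_eq (isHermitian_weightedFrameOp ψ c) isHermitian_one
      fun x => ?_
    rw [one_mulVec, ← (WithLp.ofLp_toLp 2 x), dotProduct_weightedFrameOp_mulVec, h,
      dotProduct_self_eq_norm_sq]

lemma IsScalable.exists_weightedFrameOp_eq_one {ψ : Fin M → EuclideanSpace ℝ (Fin N)}
    (hψ : IsScalable ψ) : ∃ c : Fin M → ℝ, (∀ i, 0 ≤ c i) ∧ weightedFrameOp ψ c = 1 := by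
  obtain ⟨-, s, -, A, hA, hs⟩ := hψ
  refine ⟨fun i => s i ^ 2 / A, fun i => by positivity,
    (weightedFrameOp_eq_one_iff ψ _).2 fun x => ?_⟩
  have htight := hs x
  simp only [inner_smul_right, mul_pow] at htight
  rw [← mul_right_inj' hA.ne', ← htight, Finset.mul_sum]
  exact Finset.sum_congr rfl fun i _ => by field_simp

lemma isFrame_of_weightedFrameOp_eq_one {ψ : Fin M → EuclideanSpace ℝ (Fin N)}
    {c : Fin M → ℝ} (hc : ∀ i, 0 ≤ c i) (h : weightedFrameOp ψ c = 1) : IsFrame ψ := by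
  rw [weightedFrameOp_eq_one_iff] at h
  have hsum : 0 ≤ ∑ i, c i := Finset.sum_nonneg fun i _ => hc i
  refine ⟨(1 + ∑ i, c i)⁻¹, 1 + ∑ i, ‖ψ i‖ ^ 2, by positivity, by positivity, fun x => ⟨?_, ?_⟩⟩
  · rw [inv_mul_le_iff₀ (by positivity), ← h x, Finset.mul_sum]
    refine Finset.sum_le_sum fun i hi => mul_le_mul_of_nonneg_right ?_ (sq_nonneg _)
    linarith [Finset.single_le_sum (fun j _ => hc j) hi]
  · rw [add_mul, Finset.sum_mul]
    refine le_add_of_nonneg_of_le (by positivity) (Finset.sum_le_sum fun i _ => ?_)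
    rw [← mul_pow, mul_comm, sq_le_sq, abs_of_nonneg (by positivity : 0 ≤ ‖x‖ * ‖ψ i‖)]
    exact abs_real_inner_le_norm x (ψ i)

lemma isScalable_of_weightedFrameOp_eq_one {ψ : Fin M → EuclideanSpace ℝ (Fin N)}
    {c : Fin M → ℝ} (hc : ∀ i, 0 ≤ c i) (h : weightedFrameOp ψ c = 1) : IsScalable ψ := by
  refine ⟨isFrame_of_weightedFrameOp_eq_one hc h, fun i => √(c i), fun i => Real.sqrt_nonneg _, 1,
    one_pos, fun x => ?_⟩
  simp only [inner_smul_right, mul_pow, Real.sq_sqrt (hc _), one_mul,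
    (weightedFrameOp_eq_one_iff ψ c).1 h x]

end Scalable

section Distances

open scoped Matrix.Norms.Frobenius

variable {M N : ℕ}

lemma distCone_le (φ : Fin M → EuclideanSpace ℝ (Fin N)) {c : Fin M → ℝ} (hc : ∀ i, 0 ≤ c i) :
    distCone φ ≤ ‖weightedFrameOp φ c - 1‖ := by
  rw [← frameMatrix_mul_diagonal_mul_transpose]
  exact ciInf_le ⟨0, Set.forall_mem_range.2 fun _ => norm_nonneg _⟩
    (⟨c, hc⟩ : {c : Fin M → ℝ // ∀ i, 0 ≤ c i})

lemma le_distCone {φ : Fin M → EuclideanSpace ℝ (Fin N)} {a : ℝ}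
    (h : ∀ c : Fin M → ℝ, (∀ i, 0 ≤ c i) → a ≤ ‖weightedFrameOp φ c - 1‖) : a ≤ distCone φ := by
  have : Nonempty {c : Fin M → ℝ // ∀ i, 0 ≤ c i} := ⟨⟨0, fun _ => le_rfl⟩⟩
  refine le_ciInf fun c => ?_
  rw [frameMatrix_mul_diagonal_mul_transpose]
  exact h c.1 c.2

lemma distCone_nonneg (φ : Fin M → EuclideanSpace ℝ (Fin N)) : 0 ≤ distCone φ :=
  le_distCone fun _ _ => norm_nonneg _

lemma distScalable_le (φ : Fin M → EuclideanSpace ℝ (Fin N))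
    {ψ : Fin M → EuclideanSpace ℝ (Fin N)} (hψ : IsScalable ψ) :
    distScalable φ ≤ ‖frameMatrix φ - frameMatrix ψ‖ :=
  ciInf_le ⟨0, Set.forall_mem_range.2 fun _ => norm_nonneg _⟩
    (⟨ψ, hψ⟩ : {ψ : Fin M → EuclideanSpace ℝ (Fin N) // IsScalable ψ})

lemma distScalable_nonneg (φ : Fin M → EuclideanSpace ℝ (Fin N)) : 0 ≤ distScalable φ :=
  Real.iInf_nonneg fun _ => norm_nonneg _

lemma norm_sq_frameMatrix_sub (φ ψ : Fin M → EuclideanSpace ℝ (Fin N)) :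
    ‖frameMatrix φ - frameMatrix ψ‖ ^ 2 = ∑ i, ‖φ i - ψ i‖ ^ 2 := by
  rw [frobenius_norm_sq, Finset.sum_comm]
  exact Finset.sum_congr rfl fun i _ => by simp [EuclideanSpace.norm_sq_eq, frameMatrix]

end Distances

section LowerBound

open scoped Matrix.Norms.Frobenius

lemma norm_sq_sub_inner_sq_le {E : Type*} [NormedAddCommGroup E] [InnerProductSpace ℝ E] {x : E}
    (hx : ‖x‖ = 1) (y : E) : ‖y‖ ^ 2 - inner ℝ x y ^ 2 ≤ ‖y‖ ^ 2 * ‖x - y‖ ^ 2 := by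
  rw [norm_sub_sq_real, hx]
  linarith [sq_nonneg (‖y‖ ^ 2 - inner ℝ x y)]

lemma norm_sq_smul_vecMulVec_sub {n : Type*} [Fintype n] (a b : ℝ) (x y : EuclideanSpace ℝ n) :
    ‖a • vecMulVec x.ofLp x.ofLp - b • vecMulVec y.ofLp y.ofLp‖ ^ 2 =
      a ^ 2 * (‖x‖ ^ 2) ^ 2 - 2 * a * b * inner ℝ x y ^ 2 + b ^ 2 * (‖y‖ ^ 2) ^ 2 := by
  rw [frobenius_norm_sq_eq_trace]
  simp only [transpose_sub, transpose_smul, transpose_vecMulVec, sub_mul, mul_sub, smul_mul,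
    Matrix.mul_smul, vecMulVec_mul_vecMulVec, trace_sub, trace_smul, trace_vecMulVec, smul_eq_mul,
    dotProduct_self_eq_norm_sq, ← inner_eq_dotProduct, dotProduct_smul,
    real_inner_comm x y]
  ring

lemma norm_smul_vecMulVec_sub_smul_vecMulVec_le {n : Type*} [Fintype n] {x y : EuclideanSpace ℝ n}
    (hx : ‖x‖ = 1) {c : ℝ} (hc : 0 ≤ c) (hcy : c * ‖y‖ ^ 2 ≤ 1) :
    ‖(c * ‖y‖ ^ 2) • vecMulVec x.ofLp x.ofLp - c • vecMulVec y.ofLp y.ofLp‖ ≤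
      √2 * ‖x - y‖ := by
  refine (sq_le_sq₀ (norm_nonneg _) (by positivity)).1 ?_
  calc ‖(c * ‖y‖ ^ 2) • vecMulVec x.ofLp x.ofLp - c • vecMulVec y.ofLp y.ofLp‖ ^ 2
      = 2 * c ^ 2 * ‖y‖ ^ 2 * (‖y‖ ^ 2 - inner ℝ x y ^ 2) := by
        rw [norm_sq_smul_vecMulVec_sub, hx]
        ring
    _ ≤ 2 * c ^ 2 * ‖y‖ ^ 2 * (‖y‖ ^ 2 * ‖x - y‖ ^ 2) := by
        gcongr
        exact norm_sq_sub_inner_sq_le hx y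
    _ = (c * ‖y‖ ^ 2) ^ 2 * (2 * ‖x - y‖ ^ 2) := by ring
    _ ≤ 1 * (2 * ‖x - y‖ ^ 2) := by
        gcongr
        exact pow_le_one₀ (by positivity) hcy
    _ = (√2 * ‖x - y‖) ^ 2 := by rw [one_mul, mul_pow, Real.sq_sqrt zero_le_two]

variable {M N : ℕ} {φ ψ : Fin M → EuclideanSpace ℝ (Fin N)}

lemma mul_norm_sq_le_one_of_weightedFrameOp_eq_one {c : Fin M → ℝ} (hc : ∀ i, 0 ≤ c i)
    (h : weightedFrameOp ψ c = 1) (i : Fin M) : c i * ‖ψ i‖ ^ 2 ≤ 1 := by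
  rcases eq_or_ne (ψ i) 0 with hψ | hψ
  · simp [hψ]
  · have hle : c i * inner ℝ (ψ i) (ψ i) ^ 2 ≤ ‖ψ i‖ ^ 2 := by
      rw [← (weightedFrameOp_eq_one_iff ψ c).1 h (ψ i)]
      exact Finset.single_le_sum (f := fun j => c j * inner ℝ (ψ i) (ψ j) ^ 2)
        (fun j _ => mul_nonneg (hc j) (sq_nonneg _)) (Finset.mem_univ i)
    rw [real_inner_self_eq_norm_sq, sq (‖ψ i‖ ^ 2), ← mul_assoc] at hle
    exact le_of_mul_le_mul_right (by rwa [one_mul]) (by positivity : 0 < ‖ψ i‖ ^ 2)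

/- The weights `c i * ‖ψ i‖ ^ 2` turn each rank-one summand for `ψ` into one of the same trace
for `φ`. -/
theorem distCone_le_sqrt_mul_norm_sub (hφ : ∀ i, ‖φ i‖ = 1) (hψ : IsScalable ψ) :
    distCone φ ≤ √(2 * sparsityBound M N) * ‖frameMatrix φ - frameMatrix ψ‖ := by
  obtain ⟨c₀, hc₀, hψ₀⟩ := hψ.exists_weightedFrameOp_eq_one
  obtain ⟨c, hc, hψ₁, hcard⟩ := exists_sparse_weights ψ hc₀
  rw [hψ₀] at hψ₁
  set s := Finset.univ.filter fun i => c i ≠ 0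
  have hzero : ∀ i ∉ s, (c i * ‖ψ i‖ ^ 2) • vecMulVec (φ i).ofLp (φ i).ofLp -
      c i • vecMulVec (ψ i).ofLp (ψ i).ofLp = 0 := fun i hi => by
    simp [show c i = 0 by simpa [s] using hi]
  have hcauchy : (∑ i ∈ s, ‖φ i - ψ i‖) ^ 2 ≤
      sparsityBound M N * ‖frameMatrix φ - frameMatrix ψ‖ ^ 2 := by
    rw [norm_sq_frameMatrix_sub]
    refine sq_sum_le_card_mul_sum_sq.trans (mul_le_mul hcard
      (Finset.sum_le_univ_sum_of_nonneg fun i => sq_nonneg _) (by positivity) ?_)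
    exact (Nat.cast_nonneg _).trans hcard
  calc distCone φ
      ≤ ‖weightedFrameOp φ (fun i => c i * ‖ψ i‖ ^ 2) - weightedFrameOp ψ c‖ := by
        rw [hψ₁]
        exact distCone_le φ fun i => mul_nonneg (hc i) (sq_nonneg _)
    _ = ‖∑ i ∈ s, ((c i * ‖ψ i‖ ^ 2) • vecMulVec (φ i).ofLp (φ i).ofLp -
          c i • vecMulVec (ψ i).ofLp (ψ i).ofLp)‖ := by
        rw [weightedFrameOp, weightedFrameOp, ← Finset.sum_sub_distrib,
          Finset.sum_subset (Finset.subset_univ s) fun i _ => hzero i]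
    _ ≤ ∑ i ∈ s, √2 * ‖φ i - ψ i‖ := norm_sum_le_of_le _ fun i _ =>
        norm_smul_vecMulVec_sub_smul_vecMulVec_le (hφ i) (hc i)
          (mul_norm_sq_le_one_of_weightedFrameOp_eq_one hc hψ₁ i)
    _ ≤ √2 * (√(sparsityBound M N) * ‖frameMatrix φ - frameMatrix ψ‖) := by
        rw [← Finset.mul_sum]
        gcongr
        rw [← Real.sqrt_sq (norm_nonneg (frameMatrix φ - frameMatrix ψ)),
          ← Real.sqrt_mul' _ (sq_nonneg _)]
        exact Real.le_sqrt_of_sq_le hcauchy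
    _ = √(2 * sparsityBound M N) * ‖frameMatrix φ - frameMatrix ψ‖ := by
        rw [Real.sqrt_mul zero_le_two, mul_assoc]

lemma distCone_le_sqrt_mul_distScalable (hφ : ∀ i, ‖φ i‖ = 1) (hψ : IsScalable ψ) :
    distCone φ ≤ √(2 * sparsityBound M N) * distScalable φ := by
  have : Nonempty {ψ : Fin M → EuclideanSpace ℝ (Fin N) // IsScalable ψ} := ⟨⟨ψ, hψ⟩⟩
  rw [distScalable, Real.mul_iInf_of_nonneg (Real.sqrt_nonneg _)]
  exact le_ciInf fun ψ => distCone_le_sqrt_mul_norm_sub hφ ψ.2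

end LowerBound

section UpperBound

open scoped Matrix.Norms.Frobenius

lemma det_rpow_two_div_card_le {n : Type*} [Fintype n] [DecidableEq n] [Nonempty n]
    {Q : Matrix n n ℝ} (hQ : Q.PosSemidef) :
    Q.det ^ (2 / (Fintype.card n : ℝ)) ≤ (Q.trace / Fintype.card n) ^ 2 := by
  have htr : 0 ≤ Q.trace / Fintype.card n := div_nonneg hQ.trace_nonneg (Nat.cast_nonneg _)
  calc Q.det ^ (2 / (Fintype.card n : ℝ))
      ≤ ((Q.trace / Fintype.card n) ^ Fintype.card n) ^ (2 / (Fintype.card n : ℝ)) :=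
        Real.rpow_le_rpow hQ.det_nonneg (det_le_trace_div_card_pow hQ) (by positivity)
    _ = (Q.trace / Fintype.card n) ^ 2 := by
        rw [← Real.rpow_natCast, ← Real.rpow_mul htr, mul_div_cancel₀ _ (by positivity)]
        norm_cast

lemma norm_sub_smul_toEuclideanLin_inv_sq_le {n : Type*} [Fintype n] [DecidableEq n] [Nonempty n]
    {Q : Matrix n n ℝ} (hQ : Q.PosDef) (htr : (Q * Q).trace = Fintype.card n)
    {x : EuclideanSpace ℝ n} (hx : x.ofLp ⬝ᵥ (Q * Q)⁻¹ *ᵥ x.ofLp ≤ 1) :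
    ‖x - ((Q.trace / Fintype.card n) • Q⁻¹).toEuclideanLin x‖ ^ 2 ≤
      Fintype.card n * (1 - (Q.trace / Fintype.card n) ^ 2) := by
  set α := Q.trace / Fintype.card n with hα
  have hnorm : ‖Q - α • 1‖ ^ 2 = Fintype.card n * (1 - α ^ 2) := by
    rw [norm_sub_smul_one_sq hQ.1, htr,
      show Q.trace = Fintype.card n * α by rw [hα, mul_div_cancel₀ _ (by positivity)]]
    ring
  have hfactor : x - (α • Q⁻¹).toEuclideanLin x =
      (Q - α • 1).toEuclideanLin (Q⁻¹.toEuclideanLin x) := by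
    ext j
    simp [toLpLin_apply, mul_nonsing_inv Q hQ.det_pos.ne'.isUnit]
  have hinv : ‖Q⁻¹.toEuclideanLin x‖ ^ 2 ≤ 1 := by
    rwa [norm_sq_toEuclideanLin, (isHermitian_iff_isSymm.1 hQ.inv.1).eq, ← Matrix.mul_inv_rev]
  rw [hfactor, ← hnorm]
  exact (norm_sq_toEuclideanLin_le _ _).trans (mul_le_of_le_one_right (sq_nonneg _) hinv)

variable {M N : ℕ} {φ ψ : Fin M → EuclideanSpace ℝ (Fin N)} {c : Fin M → ℝ}

lemma weightedFrameOp_congr (h : ∀ i, c i ≠ 0 → φ i = ψ i) :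
    weightedFrameOp φ c = weightedFrameOp ψ c := by
  refine Finset.sum_congr rfl fun i _ => ?_
  rcases eq_or_ne (c i) 0 with hi | hi
  · simp [hi]
  · rw [h i hi]

lemma norm_sq_frameMatrix_sub_le {b : ℝ} (h₀ : ∀ i, c i = 0 → φ i = ψ i)
    (h : ∀ i, c i ≠ 0 → ‖φ i - ψ i‖ ^ 2 ≤ b) :
    ‖frameMatrix φ - frameMatrix ψ‖ ^ 2 ≤ (Finset.univ.filter fun i => c i ≠ 0).card * b := by
  rw [norm_sq_frameMatrix_sub, ← Finset.sum_subset
    (Finset.subset_univ (Finset.univ.filter fun i => c i ≠ 0)) fun i _ hi => by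
      simp [h₀ i (by simpa using hi)], ← nsmul_eq_mul]
  exact Finset.sum_le_card_nsmul _ _ _ fun i hi => h i (Finset.mem_filter.1 hi).2

theorem IsDOptimal.exists_isScalable_norm_sq_le [Nonempty (Fin N)] (hc : IsDOptimal φ c)
    (hφ : ∀ i, ‖φ i‖ = 1) (hS : (weightedFrameOp φ c).PosDef) :
    ∃ ψ : Fin M → EuclideanSpace ℝ (Fin N), IsScalable ψ ∧
      ‖frameMatrix φ - frameMatrix ψ‖ ^ 2 ≤ (Finset.univ.filter fun i => c i ≠ 0).card *
        (N * (1 - √(weightedFrameOp φ c).det ^ (2 / (N : ℝ)))) := by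
  obtain ⟨Q, hQ, hQS⟩ := exists_posDef_mul_self_eq hS
  have hQu : IsUnit Q.det := hQ.det_pos.ne'.isUnit
  set α := Q.trace / Fintype.card (Fin N) with hα
  have hαpos : 0 < α := div_pos hQ.trace_pos (by simp [Fin.pos_iff_nonempty.2 ‹_›])
  set X := α • Q⁻¹ with hX
  let ψ : Fin M → EuclideanSpace ℝ (Fin N) := fun i =>
    if c i = 0 then φ i else X.toEuclideanLin (φ i)
  have hψ : weightedFrameOp ψ ((α ^ 2)⁻¹ • c) = 1 := by
    rw [weightedFrameOp_smul, ← weightedFrameOp_congr (φ := fun i => X.toEuclideanLin (φ i))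
      fun i hi => by simp [ψ, hi], ← mul_weightedFrameOp_mul_transpose, ← hQS, hX, transpose_smul,
      (isHermitian_iff_isSymm.1 hQ.inv.1).eq]
    simp only [smul_mul, Matrix.mul_smul, nonsing_inv_mul_cancel_left _ _ hQu,
      mul_nonsing_inv _ hQu, smul_smul]
    rw [inv_mul_eq_one₀ (by positivity) |>.2 (sq α), one_smul]
  refine ⟨ψ, isScalable_of_weightedFrameOp_eq_one
    (fun i => mul_nonneg (by positivity) (hc.nonneg i)) hψ, ?_⟩
  have hvol : √(weightedFrameOp φ c).det ^ (2 / (N : ℝ)) ≤ α ^ 2 := by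
    rw [← hQS, det_mul, Real.sqrt_mul_self hQ.det_pos.le]
    simpa only [Fintype.card_fin, hα] using det_rpow_two_div_card_le hQ.posSemidef
  have htr : (Q * Q).trace = Fintype.card (Fin N) := by
    rw [hQS, trace_weightedFrameOp hφ, hc.sum_eq]
  refine norm_sq_frameMatrix_sub_le (fun i hi => by simp [ψ, hi]) fun i hi => ?_
  calc ‖φ i - ψ i‖ ^ 2 = ‖φ i - X.toEuclideanLin (φ i)‖ ^ 2 := by simp only [ψ, if_neg hi]
    _ ≤ Fintype.card (Fin N) * (1 - α ^ 2) := norm_sub_smul_toEuclideanLin_inv_sq_le hQ htr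
        (hQS ▸ hc.dotProduct_inv_mulVec_le_one hS i)
    _ ≤ N * (1 - √(weightedFrameOp φ c).det ^ (2 / (N : ℝ))) := by
        rw [Fintype.card_fin]
        gcongr

end UpperBound

section UnitNormFrame

variable {M N : ℕ} {φ : Fin M → EuclideanSpace ℝ (Fin N)}

lemma IsDOptimal.of_weightedFrameOp_eq {c c' : Fin M → ℝ} (hc : IsDOptimal φ c)
    (hφ : ∀ i, ‖φ i‖ = 1) (hc' : ∀ i, 0 ≤ c' i) (h : weightedFrameOp φ c' = weightedFrameOp φ c) :
    IsDOptimal φ c' where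
  nonneg := hc'
  sum_eq := by rw [← trace_weightedFrameOp hφ, h, trace_weightedFrameOp hφ, hc.sum_eq]
  det_le := h ▸ hc.det_le

lemma volumeRatio_nonneg (φ : Fin M → EuclideanSpace ℝ (Fin N)) : 0 ≤ volumeRatio φ :=
  div_nonneg
    (Real.sInf_nonneg fun _ ⟨_, _, _, _, h⟩ => h ▸ MeasureTheory.measureReal_nonneg)
    MeasureTheory.measureReal_nonneg

variable [Nonempty (Fin N)]

lemma IsFrame.nonempty (hφ : IsFrame φ) : Nonempty (Fin M) := by
  by_contra h
  rw [not_nonempty_iff] at h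
  simpa [weightedFrameOp] using hφ.posDef_weightedFrameOp_one.trace_pos

namespace IsUnitNormFrame

theorem exists_sparse_isDOptimal (hφ : IsUnitNormFrame φ) :
    ∃ c, IsDOptimal φ c ∧ (weightedFrameOp φ c).PosDef ∧
      ((Finset.univ.filter fun i => c i ≠ 0).card : ℝ) ≤ sparsityBound M N := by
  have := hφ.1.nonempty
  obtain ⟨c, hc⟩ := exists_isDOptimal φ
  obtain ⟨c', hc', h, hcard⟩ := exists_sparse_weights φ hc.nonneg
  have hopt := hc.of_weightedFrameOp_eq hφ.2 hc' h
  exact ⟨c', hopt, hopt.posDef hφ.1.posDef_weightedFrameOp_one, hcard⟩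

lemma volumeRatio_le_one (hφ : IsUnitNormFrame φ) : volumeRatio φ ≤ 1 := by
  obtain ⟨c, hc, hS, -⟩ := hφ.exists_sparse_isDOptimal
  exact hc.volumeRatio_eq_sqrt_det hS ▸ Real.sqrt_le_one.2 (hc.det_le_one hφ.2)

open scoped Matrix.Norms.Frobenius in
theorem exists_isScalable_norm_le (hφ : IsUnitNormFrame φ) :
    ∃ ψ : Fin M → EuclideanSpace ℝ (Fin N), IsScalable ψ ∧ ‖frameMatrix φ - frameMatrix ψ‖ ≤
      √(sparsityBound M N * N * (1 - volumeRatio φ ^ (2 / (N : ℝ)))) := by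
  obtain ⟨c, hc, hS, hcard⟩ := hφ.exists_sparse_isDOptimal
  obtain ⟨ψ, hψ, hle⟩ := hc.exists_isScalable_norm_sq_le hφ.2 hS
  rw [← hc.volumeRatio_eq_sqrt_det hS] at hle
  refine ⟨ψ, hψ, Real.le_sqrt_of_sq_le ?_⟩
  have hV : 0 ≤ 1 - volumeRatio φ ^ (2 / (N : ℝ)) :=
    sub_nonneg.2 (Real.rpow_le_one (volumeRatio_nonneg φ) hφ.volumeRatio_le_one (by positivity))
  rw [mul_assoc]
  exact hle.trans (by gcongr)

theorem distScalable_le_sqrt (hφ : IsUnitNormFrame φ) :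
    distScalable φ ≤ √(sparsityBound M N * N * (1 - volumeRatio φ ^ (2 / (N : ℝ)))) := by
  obtain ⟨ψ, hψ, hle⟩ := hφ.exists_isScalable_norm_le
  exact (distScalable_le φ hψ).trans hle

theorem distCone_le_two_mul_sqrt_mul (hφ : IsUnitNormFrame φ) :
    distCone φ ≤ 2 * √(sparsityBound M N) * distScalable φ := by
  obtain ⟨ψ, hψ, -⟩ := hφ.exists_isScalable_norm_le
  refine (distCone_le_sqrt_mul_distScalable hφ.2 hψ).trans ?_
  rw [Real.sqrt_mul zero_le_two]
  gcongr
  · exact distScalable_nonneg φ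
  · exact Real.sqrt_le_left zero_le_two |>.2 (by norm_num)

lemma volumeRatio_rpow_le_card (hφ : IsUnitNormFrame φ) :
    volumeRatio φ ^ (4 / (N : ℝ)) ≤ N := by
  have hN : (1 : ℝ) ≤ N := by exact_mod_cast Fin.pos_iff_nonempty.2 ‹Nonempty (Fin N)›
  exact (Real.rpow_le_one (volumeRatio_nonneg φ) hφ.volumeRatio_le_one (by positivity)).trans hN

open scoped Matrix.Norms.Frobenius in
theorem sqrt_div_le_distCone (hφ : IsUnitNormFrame φ) :
    √(N * (1 - volumeRatio φ ^ (4 / (N : ℝ))) / (N - volumeRatio φ ^ (4 / (N : ℝ)))) ≤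
      distCone φ := by
  obtain ⟨c, hc, hS, -⟩ := hφ.exists_sparse_isDOptimal
  have hN : (N : ℝ) ≠ 0 := by exact_mod_cast (Fin.pos_iff_nonempty.2 ‹Nonempty (Fin N)›).ne'
  have hpow : (volumeRatio φ ^ (4 / (N : ℝ))) ^ Fintype.card (Fin N) =
      (weightedFrameOp φ c).det ^ 2 := by
    rw [Fintype.card_fin, ← Real.rpow_mul_natCast (volumeRatio_nonneg φ), div_mul_cancel₀ _ hN,
      hc.volumeRatio_eq_sqrt_det hS, ← Real.sq_sqrt hS.det_pos.le, ← pow_mul,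
      Real.sqrt_sq (Real.sqrt_nonneg _)]
    norm_cast
  refine le_distCone fun c' hc' => Real.sqrt_le_left (norm_nonneg _) |>.2 ?_
  refine div_le_of_le_mul₀ (sub_nonneg.2 hφ.volumeRatio_rpow_le_card) (sq_nonneg _) ?_
  simpa only [Fintype.card_fin] using
    hc.card_mul_one_sub_le hφ.2 (Real.rpow_nonneg (volumeRatio_nonneg φ) _) hpow hc'

theorem sqrt_div_le_volumeRatio_rpow (hφ : IsUnitNormFrame φ) (hD : distCone φ < 1) :
    √(N * (1 - distCone φ ^ 2) / (N - distCone φ ^ 2)) ≤ volumeRatio φ ^ (2 / (N : ℝ)) := by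
  have hN : (1 : ℝ) ≤ N := by exact_mod_cast Fin.pos_iff_nonempty.2 ‹Nonempty (Fin N)›
  have hD₁ : distCone φ ^ 2 < 1 := pow_lt_one₀ (distCone_nonneg φ) hD two_ne_zero
  have hsq : volumeRatio φ ^ (4 / (N : ℝ)) = (volumeRatio φ ^ (2 / (N : ℝ))) ^ 2 := by
    rw [← Real.rpow_mul_natCast (volumeRatio_nonneg φ)]
    ring_nf
  have hcone := hφ.sqrt_div_le_distCone
  have hvN := hφ.volumeRatio_rpow_le_card
  rw [Real.sqrt_le_left (Real.rpow_nonneg (volumeRatio_nonneg φ) _), ← hsq,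
    div_le_iff₀ (by linarith)]
  rcases hvN.lt_or_eq with hv | hv
  · rw [Real.sqrt_le_left (distCone_nonneg φ), div_le_iff₀ (sub_pos.2 hv)] at hcone
    linarith
  · rw [hv]
    gcongr

end IsUnitNormFrame

end UnitNormFrame

end ScalableFrame

open ScalableFrame in
theorem theorem3p3_general (M N : ℕ) (hN : 1 ≤ N) (φ : Fin M → EuclideanSpace ℝ (Fin N))
    (hφ : IsUnitNormFrame φ) (d D V K : ℝ) (hd : d = distScalable φ) (hD : D = distCone φ)
    (hV : V = volumeRatio φ) (hK : K = min (M : ℝ) ((N : ℝ) * ((N : ℝ) + 1) / 2)) :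
    D / ((D + √K) + √((D + √K) ^ 2 - D ^ 2)) ≤ d ∧
    d ≤ √(K * N * (1 - V ^ (2 / (N : ℝ)))) ∧
    (D < 1 → d ≤ √(K * N * (1 - √(N * (1 - D ^ 2) / (N - D ^ 2))))) ∧
    (2 ≤ N → ∀ δ : ℝ, δ = √(N * (1 - V ^ (4 / (N : ℝ))) / (N - V ^ (4 / (N : ℝ)))) →
      δ / ((δ + √K) + √((δ + √K) ^ 2 - δ ^ 2)) ≤ d) := by
  have : Nonempty (Fin N) := Fin.pos_iff_nonempty.1 hN
  have := hφ.1.nonempty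
  change K = sparsityBound M N at hK
  subst hd hD hV hK
  have hK : 0 < √(sparsityBound M N) := Real.sqrt_pos.2 sparsityBound_pos
  have hcone := hφ.distCone_le_two_mul_sqrt_mul
  refine ⟨div_add_add_sqrt_le (distCone_nonneg φ) hK hcone, hφ.distScalable_le_sqrt, ?_, ?_⟩
  · intro hD
    have := sparsityBound_pos (M := M) (N := N)
    refine hφ.distScalable_le_sqrt.trans ?_
    gcongr
    exact hφ.sqrt_div_le_volumeRatio_rpow hD
  · rintro - δ rfl
    exact div_add_add_sqrt_le (Real.sqrt_nonneg _) hK (hφ.sqrt_div_le_distCone.trans hcone)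

theorem theorem3p3 (M N : ℕ) (hN : 1 ≤ N) (φ : Fin M → EuclideanSpace ℝ (Fin N))
    (hφ : ScalableFrame.IsUnitNormFrame φ) (d D V K : ℝ)
    (hd : d = ScalableFrame.distScalable φ)
    (hD : D = ScalableFrame.distCone φ)
    (hV : V = ScalableFrame.volumeRatio φ)
    (hK : K = min (M : ℝ) ((N : ℝ) * ((N : ℝ) + 1) / 2))
    (hd1 : d < 1) :
    -- the two-sided estimate, with `ω = D + √K`
    D / ((D + √K) + √((D + √K) ^ 2 - D ^ 2)) ≤ d ∧
    d ≤ √(K * N * (1 - V ^ (2 / (N : ℝ)))) ∧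
    -- consequently: an upper bound in terms of `D` alone
    (D < 1 → d ≤ √(K * N * (1 - √(N * (1 - D ^ 2) / (N - D ^ 2))))) ∧
    -- consequently: a lower bound in terms of `V` alone
    (2 ≤ N → ∀ δ : ℝ, δ = √(N * (1 - V ^ (4 / (N : ℝ))) / (N - V ^ (4 / (N : ℝ)))) →
      δ / ((δ + √K) + √((δ + √K) ^ 2 - δ ^ 2)) ≤ d) := by
  exact theorem3p3_general M N hN φ hφ d D V K hd hD hV hK
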